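/- Let $G$ be a finite simple undirected graph of order $n$ that is unicyclic, i.e. connected and containing exactly one cycle, and let $k$ be the length of its unique cycle. Let $\lambda_1(G)\ge\cdots\ge\lambda_n(G)$ be the eigenvalues, with multiplicity, of the adjacency matrix of $G$, and put \[ s^+(G)=\sum_{\lambda_i(G)>0}\lambda_i(G)^2,\qquad s^-(G)=\sum_{\lambda_i(G)<0}\lambda_i(G)^2 . \] \begin{enumerate} \item[(i)] If $k\equiv 0\pmod 2$, then $s^+(G)=s^-(G)=n$. \item[(ii)] If $k\equiv 3\pmod 4$, then $s^+(G)>n>s^-(G)$. \item[(iii)] If $k\equiv 1\pmod 4$, then $s^+(G)<n<s^-(G)$. \end{enumerate} -/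

import Mathlib

namespace SimpleGraph

variable {V : Type*}

/-- A subgraph of `G` is a cycle if it is traced out by a cyclic walk. (All rotations and reversals
of such a walk trace out the same subgraph.) -/
def IsCycleSubgraph (G : SimpleGraph V) (C : G.Subgraph) : Prop :=
  ∃ (v : V) (c : G.Walk v v), c.IsCycle ∧ c.toSubgraph = C

/-- A graph is unicyclic if it is connected and contains exactly one cycle. -/
structure IsUnicyclic (G : SimpleGraph V) : Prop where
  connected : G.Connected
  existsUnique_cycle : ∃! C : G.Subgraph, G.IsCycleSubgraph C

variable [Fintype V] [DecidableEq V]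

/-- The adjacency eigenvalues of `G`, listed with multiplicity (indexed by the vertices). -/
noncomputable def adjEigenvalues (G : SimpleGraph V) [DecidableRel G.Adj] : V → ℝ :=
  (G.isHermitian_adjMatrix ℝ).eigenvalues

/-- `s⁺(G)`: the sum of the squares of the positive adjacency eigenvalues. -/
noncomputable def posSquareEnergy (G : SimpleGraph V) [DecidableRel G.Adj] : ℝ :=
  ∑ i with 0 < G.adjEigenvalues i, G.adjEigenvalues i ^ 2

/-- `s⁻(G)`: the sum of the squares of the negative adjacency eigenvalues. -/
noncomputable def negSquareEnergy (G : SimpleGraph V) [DecidableRel G.Adj] : ℝ :=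
  ∑ i with G.adjEigenvalues i < 0, G.adjEigenvalues i ^ 2

end SimpleGraph

/-!
Deleting an edge `uw` of the cycle leaves a spanning tree `T` in which `u` and `w` are at distance
`k - 1`. As `G` has `n` edges, `s⁺ + s⁻ = 2 n`, so only the sign of `s⁺ - s⁻ = ∑ λ |λ|` matters; it
is `0` for even `k`, when `G` is bipartite and its spectrum symmetric. For odd `k` and `s > 0`
consider `det (1 + i s A) = ∏ (1 + i s λ)`. The entries of `(1 + i s A_T)⁻¹` are positive multiples
of `(-i) ^ dist`, so adding `uw` as an update of rank two shows that the determinant has positive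
real part and an imaginary part of constant sign `(-1) ^ ((k - 1) / 2)`. By continuity in `s` its
argument is therefore exactly `∑ arctan (s λ)`, and the sign of this sum for all `s > 0` decides
that of `∑ λ |λ|`, since `-(π / 2) ∑ λ |λ| = 2 ∫₀^∞ s⁻³ ∑ arctan (s λ) ds` when `∑ λ = 0`.
-/

namespace SquareEnergy

open Complex (I)
open Filter Matrix SimpleGraph Topology

section Arctan

variable {ι : Type*} [Fintype ι]

theorem one_add_mul_I_eq (x : ℝ) :
    (1 + x * I : ℂ) = (√(1 + x ^ 2) : ℝ) * Complex.exp (Real.arctan x * I) := by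
  have h : √(1 + x ^ 2) ≠ 0 := by positivity
  rw [Complex.exp_mul_I, ← Complex.ofReal_cos, ← Complex.ofReal_sin, Real.cos_arctan,
    Real.sin_arctan]
  apply Complex.ext <;> simp <;> field_simp

theorem prod_one_add_mul_I_eq (x : ι → ℝ) :
    ∏ i, (1 + x i * I : ℂ) =
      (∏ i, √(1 + x i ^ 2) : ℝ) * Complex.exp ((∑ i, Real.arctan (x i) : ℝ) * I) := by
  simp_rw [one_add_mul_I_eq]
  rw [Finset.prod_mul_distrib, ← Complex.exp_sum]
  push_cast
  rw [Finset.sum_mul]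

theorem abs_sum_arctan_lt_pi_div_two {a : ι → ℝ}
    (hre : ∀ s : ℝ, 0 < s → 0 < (∏ i, (1 + (s * a i : ℝ) * I : ℂ)).re) {s : ℝ} (hs : 0 < s) :
    |∑ i, Real.arctan (s * a i)| < Real.pi / 2 := by
  have hcont : Continuous fun t : ℝ => |∑ i, Real.arctan (t * a i)| :=
    (continuous_finsetSum _ fun i _ => Real.continuous_arctan.comp (by fun_prop)).abs
  by_contra! hle
  obtain ⟨t, ht, hpi : |∑ i, Real.arctan (t * a i)| = Real.pi / 2⟩ :=
    intermediate_value_Icc hs.le hcont.continuousOn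
      (show Real.pi / 2 ∈ Set.Icc _ _ from ⟨by simpa using Real.pi_div_two_pos.le, hle⟩)
  have htpos : 0 < t := ht.1.lt_of_ne <| by
    rintro rfl
    simp only [zero_mul, Real.arctan_zero, Finset.sum_const_zero, abs_zero] at hpi
    exact Real.pi_div_two_pos.ne hpi
  have hret := hre t htpos
  rw [prod_one_add_mul_I_eq, Complex.re_ofReal_mul, Complex.exp_ofReal_mul_I_re, ← Real.cos_abs,
    hpi, Real.cos_pi_div_two, mul_zero] at hret
  exact hret.false

theorem arg_prod_one_add_mul_I {a : ι → ℝ}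
    (hre : ∀ s : ℝ, 0 < s → 0 < (∏ i, (1 + (s * a i : ℝ) * I : ℂ)).re) {s : ℝ} (hs : 0 < s) :
    (∏ i, (1 + (s * a i : ℝ) * I : ℂ)).arg = ∑ i, Real.arctan (s * a i) := by
  have hlt := abs_lt.mp (abs_sum_arctan_lt_pi_div_two hre hs)
  rw [prod_one_add_mul_I_eq, Complex.arg_real_mul _ (Finset.prod_pos fun i _ => by positivity),
    Complex.exp_mul_I, Complex.arg_cos_add_sin_mul_I]
  constructor <;> linarith [Real.pi_pos]

theorem abs_arctan_sub_self_le (x : ℝ) : |Real.arctan x - x| ≤ |x| ^ 3 := by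
  have hderiv : ∀ y ∈ Set.Icc (-|x|) |x|, HasDerivWithinAt (fun y => Real.arctan y - y)
      (1 / (1 + y ^ 2) - 1) (Set.Icc (-|x|) |x|) y := fun y _ =>
    ((Real.hasDerivAt_arctan y).sub (hasDerivAt_id' y)).hasDerivWithinAt
  have hbound : ∀ y ∈ Set.Icc (-|x|) |x|, ‖1 / (1 + y ^ 2) - 1‖ ≤ |x| ^ 2 := by
    intro y hy
    calc ‖1 / (1 + y ^ 2) - 1‖ = y ^ 2 / (1 + y ^ 2) := by
          rw [show 1 / (1 + y ^ 2) - 1 = -(y ^ 2 / (1 + y ^ 2)) by field_simp; ring, norm_neg,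
            Real.norm_of_nonneg (by positivity)]
      _ ≤ y ^ 2 := div_le_self (sq_nonneg y) (by linarith [sq_nonneg y])
      _ ≤ |x| ^ 2 := sq_le_sq.mpr (by rw [abs_abs]; exact abs_le.mpr hy)
  simpa [pow_succ] using (convex_Icc (-|x|) |x|).norm_image_sub_le_of_norm_hasDerivWithin_le
    hderiv hbound (by simp : (0 : ℝ) ∈ Set.Icc (-|x|) |x|)
    (abs_le.mp le_rfl : x ∈ Set.Icc (-|x|) |x|)

theorem hasDerivAt_inv_sq_add_sq_mul_arctan (a : ℝ) {s : ℝ} (hs : s ≠ 0) :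
    HasDerivAt (fun s : ℝ => ((s ^ 2)⁻¹ + a ^ 2) * Real.arctan (s * a))
      (-2 / s ^ 3 * Real.arctan (s * a) + a / s ^ 2) s := by
  have hleft : HasDerivAt (fun s : ℝ => (s ^ 2)⁻¹ + a ^ 2) (-2 / s ^ 3) s := by
    refine (((hasDerivAt_pow 2 s).fun_inv (by positivity)).add_const (a ^ 2)).congr_deriv ?_
    norm_num
    field_simp
  have hright : HasDerivAt (fun s : ℝ => Real.arctan (s * a)) (1 / (1 + (s * a) ^ 2) * a) s := by
    simpa using ((hasDerivAt_id s).mul_const a).arctan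
  refine (hleft.fun_mul hright).congr_deriv ?_
  have : 1 + (s * a) ^ 2 ≠ 0 := by positivity
  field_simp

theorem tendsto_inv_sq_add_sq_mul_arctan_sub_nhdsGT_zero (a : ℝ) :
    Tendsto (fun s : ℝ => ((s ^ 2)⁻¹ + a ^ 2) * Real.arctan (s * a) - a / s) (𝓝[>] 0) (𝓝 0) := by
  have hmain : Tendsto (fun s : ℝ => a ^ 2 * Real.arctan (s * a)) (𝓝[>] 0) (𝓝 0) := by
    have : Continuous fun s : ℝ => a ^ 2 * Real.arctan (s * a) :=
      continuous_const.mul (Real.continuous_arctan.comp (by fun_prop))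
    simpa using (this.tendsto 0).mono_left nhdsWithin_le_nhds
  have hrem : Tendsto (fun s : ℝ => (Real.arctan (s * a) - s * a) / s ^ 2) (𝓝[>] 0) (𝓝 0) := by
    have hbound : Tendsto (fun s : ℝ => s * |a| ^ 3) (𝓝[>] 0) (𝓝 0) := by
      simpa using ((continuous_mul_const (|a| ^ 3)).tendsto 0).mono_left nhdsWithin_le_nhds
    refine squeeze_zero_norm' ?_ hbound
    filter_upwards [self_mem_nhdsWithin] with s (hs : 0 < s)
    rw [norm_div, Real.norm_of_nonneg (sq_nonneg s), div_le_iff₀ (by positivity)]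
    calc ‖Real.arctan (s * a) - s * a‖ ≤ |s * a| ^ 3 := abs_arctan_sub_self_le _
      _ = s * |a| ^ 3 * s ^ 2 := by rw [abs_mul, abs_of_pos hs]; ring
  refine (add_zero (0 : ℝ) ▸ hmain.add hrem).congr' ?_
  filter_upwards [self_mem_nhdsWithin] with s (hs : 0 < s)
  field_simp
  ring

theorem tendsto_inv_sq_add_sq_mul_arctan_atTop (a : ℝ) :
    Tendsto (fun s : ℝ => ((s ^ 2)⁻¹ + a ^ 2) * Real.arctan (s * a)) atTop
      (𝓝 (Real.pi / 2 * (a * |a|))) := by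
  have hleft : Tendsto (fun s : ℝ => (s ^ 2)⁻¹ + a ^ 2) atTop (𝓝 (0 + a ^ 2)) :=
    (tendsto_inv_atTop_zero.comp (tendsto_pow_atTop two_ne_zero)).add_const _
  rcases lt_trichotomy a 0 with ha | rfl | ha
  · have hright : Tendsto (fun s : ℝ => Real.arctan (s * a)) atTop (𝓝 (-(Real.pi / 2))) :=
      (Real.tendsto_arctan_atBot.mono_right nhdsWithin_le_nhds).comp
        (tendsto_id.atTop_mul_const_of_neg ha)
    convert hleft.mul hright using 2
    rw [abs_of_neg ha]
    ring
  · simp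
  · have hright : Tendsto (fun s : ℝ => Real.arctan (s * a)) atTop (𝓝 (Real.pi / 2)) :=
      (Real.tendsto_arctan_atTop.mono_right nhdsWithin_le_nhds).comp
        (tendsto_id.atTop_mul_const ha)
    convert hleft.mul hright using 2
    rw [abs_of_pos ha]
    ring

theorem strictAntiOn_sum_inv_sq_add_sq_mul_arctan {a : ι → ℝ} (ha : ∑ i, a i = 0)
    (hpos : ∀ s : ℝ, 0 < s → 0 < ∑ i, Real.arctan (s * a i)) :
    StrictAntiOn (fun s : ℝ => ∑ i, ((s ^ 2)⁻¹ + a i ^ 2) * Real.arctan (s * a i))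
      (Set.Ioi 0) := by
  have hderiv : ∀ s : ℝ, 0 < s →
      HasDerivAt (fun s : ℝ => ∑ i, ((s ^ 2)⁻¹ + a i ^ 2) * Real.arctan (s * a i))
        (-2 / s ^ 3 * ∑ i, Real.arctan (s * a i)) s := by
    intro s hs
    refine (HasDerivAt.fun_sum fun i _ =>
      hasDerivAt_inv_sq_add_sq_mul_arctan (a i) hs.ne').congr_deriv ?_
    rw [Finset.sum_add_distrib, ← Finset.sum_div, ha, zero_div, add_zero, Finset.mul_sum]
  refine strictAntiOn_of_deriv_neg (convex_Ioi 0)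
    (fun s hs => (hderiv s hs).continuousAt.continuousWithinAt) fun s hs => ?_
  rw [interior_Ioi] at hs
  have hs : 0 < s := hs
  rw [(hderiv s hs).deriv]
  exact mul_neg_of_neg_of_pos (div_neg_of_neg_of_pos (by norm_num) (by positivity)) (hpos s hs)

/-- `F(s) = ∑ i, (s⁻² + aᵢ²) arctan (s aᵢ)` has derivative `-2 s⁻³ ∑ i, arctan (s aᵢ)` and decreases
from `0` at `s = 0⁺` to `(π / 2) ∑ i, aᵢ |aᵢ|` at `s = ∞`. -/
theorem sum_mul_abs_neg_of_sum_arctan_pos {a : ι → ℝ} (ha : ∑ i, a i = 0)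
    (hpos : ∀ s : ℝ, 0 < s → 0 < ∑ i, Real.arctan (s * a i)) :
    ∑ i, a i * |a i| < 0 := by
  set F : ℝ → ℝ := fun s => ∑ i, ((s ^ 2)⁻¹ + a i ^ 2) * Real.arctan (s * a i)
  have hanti : StrictAntiOn F (Set.Ioi 0) := strictAntiOn_sum_inv_sq_add_sq_mul_arctan ha hpos
  have hzero : Tendsto F (𝓝[>] 0) (𝓝 0) := by
    simpa only [Finset.sum_sub_distrib, ← Finset.sum_div, ha, zero_div, sub_zero,
      Finset.sum_const_zero] using tendsto_finsetSum Finset.univ fun i _ =>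
        tendsto_inv_sq_add_sq_mul_arctan_sub_nhdsGT_zero (a i)
  have hinf : Tendsto F atTop (𝓝 (Real.pi / 2 * ∑ i, a i * |a i|)) := by
    rw [Finset.mul_sum]
    exact tendsto_finsetSum Finset.univ fun i _ => tendsto_inv_sq_add_sq_mul_arctan_atTop (a i)
  have hone : F 1 ≤ 0 := by
    refine ge_of_tendsto hzero ?_
    filter_upwards [Ioo_mem_nhdsGT (zero_lt_one' ℝ)] with s hs
    exact (hanti hs.1 (Set.mem_Ioi.mpr one_pos) hs.2).le
  have htwo : Real.pi / 2 * ∑ i, a i * |a i| ≤ F 2 := by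
    refine le_of_tendsto hinf ?_
    filter_upwards [eventually_gt_atTop 2] with s hs
    exact (hanti (Set.mem_Ioi.mpr two_pos) (Set.mem_Ioi.mpr (two_pos.trans hs)) hs).le
  have hlt : F 2 < F 1 :=
    hanti (Set.mem_Ioi.mpr one_pos) (Set.mem_Ioi.mpr two_pos) one_lt_two
  exact (pos_iff_neg_of_mul_neg (by linarith)).mp Real.pi_div_two_pos

theorem sum_mul_abs_pos_of_sum_arctan_neg {a : ι → ℝ} (ha : ∑ i, a i = 0)
    (hneg : ∀ s : ℝ, 0 < s → ∑ i, Real.arctan (s * a i) < 0) :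
    0 < ∑ i, a i * |a i| := by
  simpa using sum_mul_abs_neg_of_sum_arctan_pos (a := fun i => -a i) (by simpa using ha)
    fun s hs => by simpa [Real.arctan_neg] using hneg s hs

theorem sum_mul_abs_neg_of_prod_re_pos_im_pos {a : ι → ℝ} (ha : ∑ i, a i = 0)
    (hre : ∀ s : ℝ, 0 < s → 0 < (∏ i, (1 + (s * a i : ℝ) * I : ℂ)).re)
    (him : ∀ s : ℝ, 0 < s → 0 < (∏ i, (1 + (s * a i : ℝ) * I : ℂ)).im) :
    ∑ i, a i * |a i| < 0 := by
  refine sum_mul_abs_neg_of_sum_arctan_pos ha fun s hs => ?_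
  rw [← arg_prod_one_add_mul_I hre hs]
  exact (Complex.arg_nonneg_iff.mpr (him s hs).le).lt_of_ne' fun h =>
    (him s hs).ne' (Complex.arg_eq_zero_iff.mp h).2

theorem sum_mul_abs_pos_of_prod_re_pos_im_neg {a : ι → ℝ} (ha : ∑ i, a i = 0)
    (hre : ∀ s : ℝ, 0 < s → 0 < (∏ i, (1 + (s * a i : ℝ) * I : ℂ)).re)
    (him : ∀ s : ℝ, 0 < s → (∏ i, (1 + (s * a i : ℝ) * I : ℂ)).im < 0) :
    0 < ∑ i, a i * |a i| := by
  refine sum_mul_abs_pos_of_sum_arctan_neg ha fun s hs => ?_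
  rw [← arg_prod_one_add_mul_I hre hs]
  exact Complex.arg_neg_iff.mpr (him s hs)

end Arctan

section ImagShift

variable {V : Type*} [DecidableEq V]

/-- The complex matrix `1 + i s A`. For a symmetric real matrix `A` with eigenvalues `λⱼ` its
determinant is `∏ j, (1 + i s λⱼ)`, whose argument is `∑ j, arctan (s λⱼ)` modulo `2 π`. -/
noncomputable def imagShift (A : Matrix V V ℝ) (s : ℝ) : Matrix V V ℂ :=
  1 + (s * I : ℂ) • A.map ((↑) : ℝ → ℂ)

theorem transpose_imagShift {A : Matrix V V ℝ} (hA : A.IsHermitian) (s : ℝ) :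
    (imagShift A s)ᵀ = imagShift A s := by
  rw [imagShift, transpose_add, transpose_one, transpose_smul, ← transpose_map,
    ← conjTranspose_eq_transpose_of_trivial, hA.eq]

theorem imagShift_add_conjTranspose {A : Matrix V V ℝ} (hA : A.IsHermitian) (s : ℝ) :
    imagShift A s + (imagShift A s)ᴴ = 2 := by
  have hmap : (A.map ((↑) : ℝ → ℂ))ᴴ = A.map ((↑) : ℝ → ℂ) := by
    rw [← conjTranspose_map _ fun x => (Complex.conj_ofReal x).symm, hA.eq]
  rw [imagShift, conjTranspose_add, conjTranspose_one, conjTranspose_smul, hmap]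
  simp only [star_mul', RCLike.star_def, Complex.conj_ofReal, Complex.conj_I, mul_neg, neg_smul]
  rw [add_add_add_comm, add_neg_cancel, add_zero, one_add_one_eq_two]

variable [Fintype V]

theorem det_imagShift {A : Matrix V V ℝ} (hA : A.IsHermitian) (s : ℝ) :
    (imagShift A s).det = ∏ i, (1 + (s * hA.eigenvalues i : ℝ) * I : ℂ) := by
  set U : Matrix V V ℝ := hA.eigenvectorUnitary.1
  set φ := Complex.ofRealHom.mapMatrix (m := V)
  have hU : φ U * φ (star U) = 1 := by
    rw [← map_mul, Unitary.mul_star_self_of_mem hA.eigenvectorUnitary.2, map_one]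
  have hspec : imagShift A s =
      φ U * diagonal (fun i => (1 + (s * hA.eigenvalues i : ℝ) * I : ℂ)) * φ (star U) := by
    have hdiag : diagonal (fun i => (1 + (s * hA.eigenvalues i : ℝ) * I : ℂ)) =
        1 + (s * I : ℂ) • φ (diagonal hA.eigenvalues) := by
      ext i j
      by_cases hij : i = j <;> simp [φ, hij, mul_right_comm]
    have hA' : A.map ((↑) : ℝ → ℂ) = φ U * φ (diagonal hA.eigenvalues) * φ (star U) := by
      rw [← map_mul, ← map_mul]
      exact congrArg φ hA.spectral_theorem
    rw [imagShift, hdiag, hA', mul_add, add_mul, mul_one, hU, mul_smul_comm, smul_mul_assoc]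
  rw [hspec, det_conj_of_mul_eq_one hU (mul_eq_one_comm.mp hU), det_diagonal]

theorem isUnit_det_imagShift {A : Matrix V V ℝ} (hA : A.IsHermitian) (s : ℝ) :
    IsUnit (imagShift A s).det := by
  rw [det_imagShift hA, isUnit_iff_ne_zero, Finset.prod_ne_zero_iff]
  intro i _ h
  simpa using congrArg Complex.re h

theorem inv_imagShift_apply_comm {A : Matrix V V ℝ} (hA : A.IsHermitian) (s : ℝ) (u v : V) :
    (imagShift A s)⁻¹ u v = (imagShift A s)⁻¹ v u := by
  conv_lhs => rw [← transpose_imagShift hA, ← transpose_nonsing_inv, transpose_apply]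

/-- Conjugating `B + Bᴴ = 2` by `B⁻¹`, where `B = 1 + i s A`. -/
theorem inv_imagShift_mul_conjTranspose {A : Matrix V V ℝ} (hA : A.IsHermitian) (s : ℝ) :
    (imagShift A s)⁻¹ * ((imagShift A s)⁻¹)ᴴ = (imagShift A s)⁻¹.map fun z => (z.re : ℂ) := by
  set B := imagShift A s
  have hB : IsUnit B.det := isUnit_det_imagShift hA s
  have hBH : Bᴴ * (B⁻¹)ᴴ = 1 := by
    rw [← conjTranspose_mul, nonsing_inv_mul _ hB, conjTranspose_one]
  have hsum : (2 : ℂ) • (B⁻¹ * (B⁻¹)ᴴ) = (B⁻¹)ᴴ + B⁻¹ :=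
    calc (2 : ℂ) • (B⁻¹ * (B⁻¹)ᴴ) = B⁻¹ * (B + Bᴴ) * (B⁻¹)ᴴ := by
          rw [imagShift_add_conjTranspose hA, two_smul, mul_two, add_mul]
      _ = (B⁻¹)ᴴ + B⁻¹ := by
          rw [mul_add, add_mul, nonsing_inv_mul _ hB, one_mul, Matrix.mul_assoc, hBH, mul_one]
  ext u v
  have huv := congrFun₂ hsum u v
  rw [Matrix.smul_apply, Matrix.add_apply, conjTranspose_apply, inv_imagShift_apply_comm hA s v u,
    RCLike.star_def, add_comm, Complex.add_conj, smul_eq_mul, Complex.ofReal_mul] at huv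
  exact mul_left_cancel₀ two_ne_zero huv

open scoped ComplexOrder in
theorem inv_imagShift_apply_re_sq_le {A : Matrix V V ℝ} (hA : A.IsHermitian) (s : ℝ) (u v : V) :
    ((imagShift A s)⁻¹ u v).re ^ 2 ≤
      ((imagShift A s)⁻¹ u u).re * ((imagShift A s)⁻¹ v v).re := by
  have hdet := ((posSemidef_self_mul_conjTranspose (imagShift A s)⁻¹).submatrix ![u, v]).det_nonneg
  rw [inv_imagShift_mul_conjTranspose hA, det_fin_two] at hdet
  simp only [submatrix_apply, map_apply, cons_val_zero, cons_val_one,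
    inv_imagShift_apply_comm hA s v u] at hdet
  norm_cast at hdet
  linarith

theorem det_add_smul_single_add_single {R : Type*} [CommRing R] {B : Matrix V V R}
    (hB : IsUnit B.det) (z : R) (u v : V) :
    (B + z • (single u v 1 + single v u 1)).det =
      B.det * ((1 + z * B⁻¹ v u) * (1 + z * B⁻¹ u v) - z ^ 2 * (B⁻¹ u u * B⁻¹ v v)) := by
  have hfactor : z • (single u v 1 + single v u 1) =
      (z • (1 : Matrix V V R).submatrix id ![u, v]) * (1 : Matrix V V R).submatrix ![v, u] id := by
    ext i j
    rw [mul_apply, Fin.sum_univ_two]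
    simp only [Matrix.smul_apply, Matrix.add_apply, submatrix_apply, single_apply, one_apply,
      cons_val_zero, cons_val_one, id, smul_eq_mul]
    grind
  have hinv : (1 : Matrix V V R).submatrix ![v, u] id * B⁻¹ *
      (z • (1 : Matrix V V R).submatrix id ![u, v]) = z • B⁻¹.submatrix ![v, u] ![u, v] := by
    rw [Matrix.mul_smul, ← Equiv.coe_refl, one_submatrix_mul, mul_submatrix_one]
    rfl
  rw [hfactor, det_add_mul _ _ hB, hinv, det_fin_two]
  simp only [Matrix.smul_apply, Matrix.add_apply, submatrix_apply, one_apply_eq, cons_val_zero,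
    cons_val_one, smul_eq_mul, ne_eq, zero_ne_one, one_ne_zero, not_false_eq_true, one_apply_ne]
  ring

end ImagShift

section OddSpectralSum

variable {V : Type*} [Fintype V] [DecidableEq V]

theorem charpoly_neg {R : Type*} [CommRing R] (A : Matrix V V R) :
    (-A).charpoly = (-1) ^ Fintype.card V * A.charpoly.comp (-Polynomial.X) := by
  have h : (-A).charmatrix =
      -(Polynomial.compRingHom (-Polynomial.X)).mapMatrix A.charmatrix := by
    ext1 i j
    by_cases hij : i = j <;> simp [hij, add_comm]
  rw [charpoly, h, det_neg, ← RingHom.map_det]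
  rfl

theorem sum_eigenvalues_eq_zero_of_charpoly_neg_eq {A : Matrix V V ℝ} (hA : A.IsHermitian)
    (hneg : (-A).charpoly = A.charpoly) {f : ℝ → ℝ} (hf : ∀ x, f (-x) = -f x) :
    ∑ i, f (hA.eigenvalues i) = 0 := by
  have hroots : A.charpoly.roots.map (fun x => -x) = A.charpoly.roots := by
    conv_rhs => rw [← hneg, charpoly_neg, ← Polynomial.C_1, ← Polynomial.C_neg, ← Polynomial.C_pow,
      Polynomial.roots_C_mul _ (by simp), Polynomial.roots_comp_neg_X]
  have hsum : (A.charpoly.roots.map f).sum = ∑ i, f (hA.eigenvalues i) := by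
    rw [hA.roots_charpoly_eq_eigenvalues, Multiset.map_map]
    rfl
  have hself : (A.charpoly.roots.map f).sum = -(A.charpoly.roots.map f).sum := by
    conv_lhs => rw [← hroots, Multiset.map_map]
    simp only [Function.comp_def, hf, Multiset.sum_map_neg]
  rw [← hsum]
  exact self_eq_neg.mp hself

theorem charpoly_neg_adjMatrix_of_isBipartite {R : Type*} [CommRing R] {G : SimpleGraph V}
    [DecidableRel G.Adj] (hG : G.IsBipartite) :
    (-G.adjMatrix R).charpoly = (G.adjMatrix R).charpoly := by
  have C : G.Coloring Bool := hG.toColoring (by simp)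
  set ε : V → R := fun v => if C v then 1 else -1
  have hε : diagonal ε * diagonal ε = 1 := by
    rw [diagonal_mul_diagonal, ← diagonal_one]
    congr 1
    ext v
    by_cases h : C v <;> simp [ε, h]
  have hconj : diagonal ε * G.adjMatrix R * diagonal ε = -G.adjMatrix R := by
    ext u v
    rw [mul_diagonal, diagonal_mul, neg_apply, adjMatrix_apply]
    split_ifs with h
    · have := C.valid h
      by_cases hu : C u <;> by_cases hv : C v <;> simp_all [ε]
    · simp
  rw [← hconj, charpoly_mul_comm, ← Matrix.mul_assoc, hε, one_mul]

theorem sum_adjEigenvalues_eq_zero_of_isBipartite {G : SimpleGraph V} [DecidableRel G.Adj]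
    (hG : G.IsBipartite) {f : ℝ → ℝ} (hf : ∀ x, f (-x) = -f x) :
    ∑ i, f (G.adjEigenvalues i) = 0 :=
  sum_eigenvalues_eq_zero_of_charpoly_neg_eq _ (charpoly_neg_adjMatrix_of_isBipartite hG) hf

theorem exists_det_imagShift_adjMatrix_eq_of_isBipartite {G : SimpleGraph V}
    [DecidableRel G.Adj] (hG : G.IsBipartite) (s : ℝ) :
    ∃ d : ℝ, 0 < d ∧ (imagShift (G.adjMatrix ℝ) s).det = d := by
  refine ⟨∏ i, √(1 + (s * G.adjEigenvalues i) ^ 2), Finset.prod_pos fun i _ => by positivity, ?_⟩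
  have hsum : ∑ i, Real.arctan (s * G.adjEigenvalues i) = 0 :=
    sum_adjEigenvalues_eq_zero_of_isBipartite hG (f := fun x => Real.arctan (s * x)) fun x => by
      rw [mul_neg, Real.arctan_neg]
  rw [det_imagShift (G.isHermitian_adjMatrix ℝ), prod_one_add_mul_I_eq]
  change (_ * Complex.exp ((∑ i, Real.arctan (s * G.adjEigenvalues i) : ℝ) * I) : ℂ) = _
  rw [hsum, Complex.ofReal_zero, zero_mul, Complex.exp_zero, mul_one]
  rfl

end OddSpectralSum

section RootedTree

variable {V : Type*} [Fintype V] {T : SimpleGraph V} [DecidableRel T.Adj]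

variable (T) in
/-- The children of the vertex `x` of the tree `T` rooted at `u`. -/
noncomputable def childFinset (u x : V) : Finset V :=
  {c ∈ T.neighborFinset x | T.dist u c = T.dist u x + 1}

theorem mem_childFinset {u x c : V} :
    c ∈ childFinset T u x ↔ T.Adj x c ∧ T.dist u c = T.dist u x + 1 := by
  rw [childFinset, Finset.mem_filter, mem_neighborFinset]

theorem childFinset_root (u : V) : childFinset T u u = T.neighborFinset u := by
  ext c
  rw [mem_childFinset, mem_neighborFinset, dist_self, zero_add, dist_eq_one_iff_adj, and_self]

theorem exists_mem_childFinset (hT : T.IsTree) {u x : V} (hx : x ≠ u) :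
    ∃ p, x ∈ childFinset T u p := by
  obtain ⟨P, -, hP⟩ := hT.connected.exists_path_of_dist u x
  have hnil : ¬P.Nil := fun h => hx h.eq.symm
  refine ⟨P.penultimate, mem_childFinset.mpr ⟨P.adj_penultimate hnil, ?_⟩⟩
  have hle : T.dist u P.penultimate ≤ P.dropLast.length := dist_le _
  have hlen : P.dropLast.length + 1 = P.length := Walk.length_dropLast_add_one hnil
  have hcases := hT.dist_eq_dist_add_one_of_adj u (P.adj_penultimate hnil)
  omega

theorem eq_of_mem_childFinset (hT : T.IsTree) {u x p q : V} (hp : x ∈ childFinset T u p)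
    (hq : x ∈ childFinset T u q) : p = q := by
  obtain ⟨hpx, hdp⟩ := mem_childFinset.mp hp
  obtain ⟨hqx, hdq⟩ := mem_childFinset.mp hq
  obtain ⟨P, -, hP⟩ := hT.connected.exists_path_of_dist u p
  obtain ⟨Q, -, hQ⟩ := hT.connected.exists_path_of_dist u q
  have hPx : (P.concat hpx).IsPath := Walk.isPath_of_length_eq_dist _ (by simp [hP, hdp])
  have hQx : (Q.concat hqx).IsPath := Walk.isPath_of_length_eq_dist _ (by simp [hQ, hdq])
  simpa using congrArg Walk.penultimate ((hT.existsUnique_path u x).unique hPx hQx)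

theorem sum_neighborFinset_of_mem_childFinset {M : Type*} [AddCommMonoid M] (hT : T.IsTree)
    {u p x : V} (hx : x ∈ childFinset T u p) (f : V → M) :
    ∑ y ∈ T.neighborFinset x, f y = f p + ∑ y ∈ childFinset T u x, f y := by
  classical
  obtain ⟨hadj, hdist⟩ := mem_childFinset.mp hx
  have hp : p ∉ childFinset T u x := fun h => by
    have := (mem_childFinset.mp h).2
    omega
  have hnbr : T.neighborFinset x = insert p (childFinset T u x) := by
    ext y
    rw [mem_neighborFinset, Finset.mem_insert]
    refine ⟨fun hy => ?_, ?_⟩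
    · rcases hT.dist_eq_dist_add_one_of_adj u hy with h | h
      · exact .inl (eq_of_mem_childFinset hT (mem_childFinset.mpr ⟨hy.symm, h⟩) hx)
      · exact .inr (mem_childFinset.mpr ⟨hy, h⟩)
    · rintro (rfl | h)
      exacts [hadj.symm, (mem_childFinset.mp h).1]
  rw [hnbr, Finset.sum_insert hp]

/-- The continued fraction `q x = 1 + ∑ s² / q c`, over the children `c` of `x`, is positive. -/
theorem exists_add_sum_childFinset_eq_mul (hT : T.IsTree) {u : V} {s : ℝ} {z : V → ℂ}
    (hz : ∀ x, x ≠ u → z x + s * I * ∑ y ∈ T.neighborFinset x, z y = 0) (x : V) :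
    ∃ q : ℝ, 0 < q ∧ z x + s * I * ∑ c ∈ childFinset T u x, z c = q * z x := by
  obtain ⟨N, hN⟩ : ∃ N, ∀ y, T.dist u y ≤ N :=
    ⟨Finset.univ.sup (T.dist u), fun y => Finset.le_sup (Finset.mem_univ y)⟩
  induction hm : N - T.dist u x using Nat.strong_induction_on generalizing x with
  | _ m ih =>
    subst hm
    have hchild : ∀ c ∈ childFinset T u x, ∃ r : ℝ, 0 < r ∧ z c = -(s * I) * r * z x := by
      intro c hc
      have hdist := (mem_childFinset.mp hc).2
      have hcu : c ≠ u := by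
        rintro rfl
        simp at hdist
      obtain ⟨q, hq, hqc⟩ := ih _ (by have := hN c; omega) c rfl
      have hzc := hz c hcu
      rw [sum_neighborFinset_of_mem_childFinset hT hc] at hzc
      have hq' : (q : ℂ) ≠ 0 := Complex.ofReal_ne_zero.mpr hq.ne'
      refine ⟨q⁻¹, inv_pos.mpr hq, ?_⟩
      push_cast
      field_simp
      linear_combination hzc - hqc
    choose! r hr hzr using hchild
    refine ⟨1 + s ^ 2 * ∑ c ∈ childFinset T u x, r c, ?_, ?_⟩
    · have := Finset.sum_nonneg fun c hc => (hr c hc).le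
      positivity
    · rw [Finset.sum_congr rfl hzr, ← Finset.sum_mul, ← Finset.mul_sum]
      push_cast
      linear_combination -(s ^ 2 * (∑ c ∈ childFinset T u x, (r c : ℂ)) * z x) * Complex.I_sq

theorem exists_eq_neg_I_pow_dist_mul (hT : T.IsTree) {u : V} {s : ℝ} (hs : 0 < s) {z : V → ℂ}
    (hroot : z u + s * I * ∑ y ∈ T.neighborFinset u, z y = 1)
    (hz : ∀ x, x ≠ u → z x + s * I * ∑ y ∈ T.neighborFinset x, z y = 0) (x : V) :
    ∃ r : ℝ, 0 < r ∧ z x = (-I) ^ T.dist u x * r := by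
  induction hm : T.dist u x generalizing x with
  | zero =>
    obtain rfl : u = x := hT.connected.dist_eq_zero_iff.mp hm
    obtain ⟨q, hq, hqu⟩ := exists_add_sum_childFinset_eq_mul hT hz u
    rw [childFinset_root, hroot] at hqu
    refine ⟨q⁻¹, inv_pos.mpr hq, ?_⟩
    rw [pow_zero, one_mul, Complex.ofReal_inv]
    exact eq_inv_of_mul_eq_one_right hqu.symm
  | succ m ih =>
    have hxu : x ≠ u := by
      rintro rfl
      simp at hm
    obtain ⟨p, hp⟩ := exists_mem_childFinset hT hxu
    have hdist := (mem_childFinset.mp hp).2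
    obtain ⟨r, hr, hzp⟩ := ih p (by omega)
    obtain ⟨q, hq, hqx⟩ := exists_add_sum_childFinset_eq_mul hT hz x
    have hzx := hz x hxu
    rw [sum_neighborFinset_of_mem_childFinset hT hp, hzp] at hzx
    have hq' : (q : ℂ) ≠ 0 := Complex.ofReal_ne_zero.mpr hq.ne'
    refine ⟨s * r / q, by positivity, ?_⟩
    push_cast
    field_simp
    linear_combination hzx - hqx

variable [DecidableEq V]

theorem imagShift_adjMatrix_mul_apply {G : SimpleGraph V} [DecidableRel G.Adj] (s : ℝ)
    (M : Matrix V V ℂ) (x y : V) :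
    (imagShift (G.adjMatrix ℝ) s * M) x y =
      M x y + s * I * ∑ w ∈ G.neighborFinset x, M w y := by
  have hmap : (G.adjMatrix ℝ).map ((↑) : ℝ → ℂ) = G.adjMatrix ℂ := by
    ext i j
    simp [adjMatrix_apply, apply_ite]
  rw [imagShift, add_mul, one_mul, smul_mul_assoc, hmap, Matrix.add_apply, Matrix.smul_apply,
    adjMatrix_mul_apply, smul_eq_mul]

theorem exists_inv_imagShift_adjMatrix_apply_eq (hT : T.IsTree) {s : ℝ} (hs : 0 < s) (u x : V) :
    ∃ r : ℝ, 0 < r ∧ (imagShift (T.adjMatrix ℝ) s)⁻¹ x u = (-I) ^ T.dist u x * r := by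
  have hinv := mul_nonsing_inv _ (isUnit_det_imagShift (T.isHermitian_adjMatrix ℝ) s)
  refine exists_eq_neg_I_pow_dist_mul hT hs
    (z := fun y => (imagShift (T.adjMatrix ℝ) s)⁻¹ y u) ?_ (fun y hy => ?_) x
  · rw [← imagShift_adjMatrix_mul_apply, hinv, one_apply_eq]
  · rw [← imagShift_adjMatrix_mul_apply, hinv, one_apply_ne hy]

end RootedTree

section Unicyclic

variable {V : Type*} {G T : SimpleGraph V}

theorem dist_eq_length_of_isPath (hT : T.IsTree) {u v : V} {p : T.Walk u v} (hp : p.IsPath) :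
    T.dist u v = p.length := by
  obtain ⟨q, hq, hql⟩ := hT.connected.exists_path_of_dist u v
  rw [← hql, (hT.existsUnique_path u v).unique hq hp]

theorem exists_isTree_sup_edge_of_isUnicyclic (hG : G.IsUnicyclic) {v : V} {c : G.Walk v v}
    (hc : c.IsCycle) : ∃ (T : SimpleGraph V) (u w : V), T.IsTree ∧ u ≠ w ∧ ¬T.Adj u w ∧
      T.dist u w + 1 = c.length ∧ G = T ⊔ edge u w := by
  cases c with
  | nil => exact absurd rfl hc.ne_nil
  | @cons _ w _ hvw p =>
    obtain ⟨hp, hvwp⟩ := (Walk.cons_isCycle_iff p hvw).mp hc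
    set T := G.deleteEdges {s(v, w)} with hT
    have hmem : s(v, w) ∈ (Walk.cons hvw p).edges := by simp
    have hconn : T.Connected := hG.connected.connected_delete_edge_of_not_isBridge
      fun hb => hb.notMem_edges_of_isCycle hc hmem
    have hacyc : T.IsAcyclic := fun x d hd => by
      have hle : T ≤ G := deleteEdges_le _
      have heq := hG.existsUnique_cycle.unique ⟨_, _, hd.mapLe hle, rfl⟩ ⟨_, _, hc, rfl⟩
      have hmem' : s(v, w) ∈ (d.mapLe hle).edges := by
        rwa [← Walk.mem_edges_toSubgraph, heq, Walk.mem_edges_toSubgraph]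
      rw [Walk.edges_mapLe_eq_edges] at hmem'
      simpa [hT] using d.edges_subset_edgeSet hmem'
    refine ⟨T, v, w, ⟨hconn, hacyc⟩, hvw.ne, by simp [hT], ?_, ?_⟩
    · have hpT : ∀ e ∈ p.edges, e ∉ ({s(v, w)} : Set (Sym2 V)) := by
        rintro e he rfl
        exact hvwp he
      rw [dist_comm, dist_eq_length_of_isPath ⟨hconn, hacyc⟩ (hp.toDeleteEdges G _ hpT)]
      rw [Walk.length_cons, Walk.toDeleteEdges, Walk.length_transfer]
    · ext x y
      simp only [hT, sup_adj, deleteEdges_adj, edge_adj, Set.mem_singleton_iff, Sym2.eq_iff]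
      grind [hvw.ne, hvw.symm]

theorem isBipartite_sup_edge (hT : T.IsBipartite) {u w : V} (p : T.Walk u w)
    (hp : Odd p.length) : (T ⊔ edge u w).IsBipartite := by
  have C : T.Coloring Bool := hT.toColoring (by simp)
  have huw : C u ≠ C w := by
    have := (C.odd_length_iff_not_congr p).mp hp
    grind
  refine (Coloring.mk C fun {x y} h => ?_ : (T ⊔ edge u w).Coloring Bool).colorable
  rw [sup_adj, edge_adj] at h
  rcases h with h | ⟨⟨rfl, rfl⟩ | ⟨rfl, rfl⟩, -⟩
  exacts [C.valid h, huw, huw.symm]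

variable [DecidableEq V]

theorem adjMatrix_sup_edge {R : Type*} [AddMonoidWithOne R] [DecidableRel T.Adj] {u w : V}
    (hne : u ≠ w) (hadj : ¬T.Adj u w) [DecidableRel (T ⊔ edge u w).Adj] :
    (T ⊔ edge u w).adjMatrix R = T.adjMatrix R + (single u w 1 + single w u 1) := by
  have hadj' : ¬T.Adj w u := fun h => hadj h.symm
  ext x y
  simp only [adjMatrix_apply, sup_adj, edge_adj, Matrix.add_apply, single_apply]
  grind

theorem imagShift_adjMatrix_sup_edge [DecidableRel T.Adj] {u w : V} (hne : u ≠ w)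
    (hadj : ¬T.Adj u w) [DecidableRel (T ⊔ edge u w).Adj] (s : ℝ) :
    imagShift ((T ⊔ edge u w).adjMatrix ℝ) s =
      imagShift (T.adjMatrix ℝ) s + (s * I : ℂ) • (single u w 1 + single w u 1) := by
  have hsingle (x y : V) : (single x y (1 : ℝ)).map ((↑) : ℝ → ℂ) = single x y 1 :=
    (map_single x y 1 Complex.ofRealHom).trans (by rw [map_one])
  rw [imagShift, imagShift, adjMatrix_sup_edge hne hadj, Matrix.map_add _ Complex.ofReal_add,
    Matrix.map_add _ Complex.ofReal_add, hsingle, hsingle, smul_add, add_assoc]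

variable [Fintype V]

theorem exists_det_imagShift_adjMatrix_sup_edge_eq (hT : T.IsTree) {u w : V} (hne : u ≠ w)
    (hadj : ¬T.Adj u w) [DecidableRel (T ⊔ edge u w).Adj] {m : ℕ} (hm : T.dist u w = 2 * m)
    {s : ℝ} (hs : 0 < s) : ∃ a b : ℝ, 0 < a ∧ 0 < b ∧
      (imagShift ((T ⊔ edge u w).adjMatrix ℝ) s).det = a + (-1) ^ m * b * I := by
  classical
  have hA := T.isHermitian_adjMatrix ℝ
  obtain ⟨d, hd, hdet⟩ := exists_det_imagShift_adjMatrix_eq_of_isBipartite hT.isBipartite s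
  obtain ⟨p, -, huu⟩ := exists_inv_imagShift_adjMatrix_apply_eq hT hs u u
  obtain ⟨q, -, hww⟩ := exists_inv_imagShift_adjMatrix_apply_eq hT hs w w
  obtain ⟨r, hr, hwu⟩ := exists_inv_imagShift_adjMatrix_apply_eq hT hs u w
  rw [SimpleGraph.dist_self, pow_zero, one_mul] at huu hww
  rw [hm, pow_mul, neg_sq, Complex.I_sq] at hwu
  have huw := (inv_imagShift_apply_comm hA s u w).trans hwu
  have hσ : ((-1 : ℂ) ^ m) ^ 2 = 1 := by rw [← pow_mul, pow_mul', neg_one_sq, one_pow]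
  have hminor : r ^ 2 ≤ p * q := by
    have hre : (((-1) ^ m * r : ℂ)).re = (-1) ^ m * r := by
      rw [← Complex.ofReal_re ((-1) ^ m * r)]
      push_cast
      rfl
    have hle := inv_imagShift_apply_re_sq_le hA s u w
    rwa [huw, huu, hww, hre, Complex.ofReal_re, Complex.ofReal_re, mul_pow, ← pow_mul, pow_mul',
      neg_one_sq, one_pow, one_mul] at hle
  refine ⟨d * (1 + s ^ 2 * (p * q - r ^ 2)), d * (2 * s * r), ?_, by positivity, ?_⟩
  · have := mul_nonneg (sq_nonneg s) (sub_nonneg.mpr hminor)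
    positivity
  · rw [imagShift_adjMatrix_sup_edge hne hadj,
      det_add_smul_single_add_single (isUnit_det_imagShift hA s), hdet, huw, hwu, huu, hww]
    push_cast
    linear_combination d * s ^ 2 * (r ^ 2 * ((-1) ^ m) ^ 2 - p * q) * Complex.I_sq -
      d * s ^ 2 * r ^ 2 * hσ

theorem prod_one_add_mul_adjEigenvalues_mul_I [DecidableRel G.Adj] (s : ℝ) :
    ∏ i, (1 + (s * G.adjEigenvalues i : ℝ) * I : ℂ) = (imagShift (G.adjMatrix ℝ) s).det :=
  (det_imagShift (G.isHermitian_adjMatrix ℝ) s).symm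

end Unicyclic

section Spectrum

variable {V : Type*} [Fintype V] [DecidableEq V]

section General

variable (G : SimpleGraph V) [DecidableRel G.Adj]

theorem sum_adjEigenvalues : ∑ i, G.adjEigenvalues i = 0 := by
  rw [← trace_adjMatrix ℝ G]
  exact (G.isHermitian_adjMatrix ℝ).trace_eq_sum_eigenvalues.symm

theorem sum_adjEigenvalues_sq : ∑ i, G.adjEigenvalues i ^ 2 = 2 * G.edgeFinset.card := by
  have hspec : (G.adjMatrix ℝ * G.adjMatrix ℝ).trace = ∑ i, G.adjEigenvalues i ^ 2 := by
    conv_lhs => rw [(G.isHermitian_adjMatrix ℝ).spectral_theorem]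
    rw [← map_mul, Unitary.conjStarAlgAut_apply, trace_mul_cycle, Unitary.coe_star_mul_self,
      one_mul, diagonal_mul_diagonal, trace_diagonal]
    exact Finset.sum_congr rfl fun i _ => (sq _).symm
  rw [← hspec]
  simp only [trace, diag_apply, adjMatrix_mul_self_apply_self]
  exact_mod_cast G.sum_degrees_eq_twice_card_edges

theorem posSquareEnergy_add_negSquareEnergy :
    G.posSquareEnergy + G.negSquareEnergy = 2 * G.edgeFinset.card := by
  rw [← sum_adjEigenvalues_sq, posSquareEnergy, negSquareEnergy, Finset.sum_filter,
    Finset.sum_filter, ← Finset.sum_add_distrib]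
  refine Finset.sum_congr rfl fun i _ => ?_
  rcases lt_trichotomy (G.adjEigenvalues i) 0 with h | h | h
  · simp [h, h.le]
  · simp [h]
  · simp [h, h.le]

theorem posSquareEnergy_sub_negSquareEnergy :
    G.posSquareEnergy - G.negSquareEnergy = ∑ i, G.adjEigenvalues i * |G.adjEigenvalues i| := by
  rw [posSquareEnergy, negSquareEnergy, Finset.sum_filter, Finset.sum_filter,
    ← Finset.sum_sub_distrib]
  refine Finset.sum_congr rfl fun i _ => ?_
  rcases lt_trichotomy (G.adjEigenvalues i) 0 with h | h | h
  · simp [h, h.le, abs_of_neg, sq]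
  · simp [h]
  · simp [h, h.le, abs_of_pos, sq]

variable {G} in
theorem posSquareEnergy_eq_negSquareEnergy_of_isBipartite (hG : G.IsBipartite) :
    G.posSquareEnergy = G.negSquareEnergy := by
  rw [← sub_eq_zero, posSquareEnergy_sub_negSquareEnergy]
  exact sum_adjEigenvalues_eq_zero_of_isBipartite hG (f := fun x => x * |x|) fun x => by
    rw [abs_neg, neg_mul]

end General

variable {T : SimpleGraph V} {u w : V} [DecidableRel (T ⊔ edge u w).Adj]

theorem posSquareEnergy_add_negSquareEnergy_sup_edge (hT : T.IsTree) (hne : u ≠ w)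
    (hadj : ¬T.Adj u w) :
    (T ⊔ edge u w).posSquareEnergy + (T ⊔ edge u w).negSquareEnergy = 2 * Fintype.card V := by
  classical
  rw [posSquareEnergy_add_negSquareEnergy, ← hT.card_edgeFinset,
    ← card_edgeFinset_sup_edge T hadj hne]
  congr!

theorem posSquareEnergy_lt_negSquareEnergy_sup_edge (hT : T.IsTree) (hne : u ≠ w)
    (hadj : ¬T.Adj u w) {m : ℕ} (hm : Even m) (hdist : T.dist u w = 2 * m) :
    (T ⊔ edge u w).posSquareEnergy < (T ⊔ edge u w).negSquareEnergy := by
  rw [← sub_neg, posSquareEnergy_sub_negSquareEnergy]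
  refine sum_mul_abs_neg_of_prod_re_pos_im_pos (sum_adjEigenvalues _) (fun s hs => ?_)
    fun s hs => ?_
  all_goals
    obtain ⟨a, b, ha, hb, hdet⟩ := exists_det_imagShift_adjMatrix_sup_edge_eq hT hne hadj hdist hs
    rw [prod_one_add_mul_adjEigenvalues_mul_I, hdet, hm.neg_one_pow]
    simpa

theorem negSquareEnergy_lt_posSquareEnergy_sup_edge (hT : T.IsTree) (hne : u ≠ w)
    (hadj : ¬T.Adj u w) {m : ℕ} (hm : Odd m) (hdist : T.dist u w = 2 * m) :
    (T ⊔ edge u w).negSquareEnergy < (T ⊔ edge u w).posSquareEnergy := by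
  rw [← sub_pos, posSquareEnergy_sub_negSquareEnergy]
  refine sum_mul_abs_pos_of_prod_re_pos_im_neg (sum_adjEigenvalues _) (fun s hs => ?_)
    fun s hs => ?_
  all_goals
    obtain ⟨a, b, ha, hb, hdet⟩ := exists_det_imagShift_adjMatrix_sup_edge_eq hT hne hadj hdist hs
    rw [prod_one_add_mul_adjEigenvalues_mul_I, hdet, hm.neg_one_pow]
    simpa

end Spectrum

end SquareEnergy

open SquareEnergy

theorem theorem1p2 {V : Type*} [Fintype V] [DecidableEq V]
    (G : SimpleGraph V) [DecidableRel G.Adj] (n k : ℕ)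
    (hG : G.IsUnicyclic) (hn : Fintype.card V = n)
    {v : V} (c : G.Walk v v) (hc : c.IsCycle) (hk : c.length = k) :
    (k ≡ 0 [MOD 2] → G.posSquareEnergy = n ∧ G.negSquareEnergy = n) ∧
    (k ≡ 3 [MOD 4] → G.posSquareEnergy > n ∧ n > G.negSquareEnergy) ∧
    (k ≡ 1 [MOD 4] → G.posSquareEnergy < n ∧ n < G.negSquareEnergy) := by
  obtain ⟨T, u, w, hT, hne, hadj, hdist, rfl⟩ := exists_isTree_sup_edge_of_isUnicyclic hG hc
  have hsum := posSquareEnergy_add_negSquareEnergy_sup_edge hT hne hadj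
  rw [hk] at hdist
  rw [hn] at hsum
  unfold Nat.ModEq
  refine ⟨fun h => ?_, fun h => ?_, fun h => ?_⟩
  · obtain ⟨p, hp⟩ := hT.connected.exists_walk_length_eq_dist u w
    have heq := posSquareEnergy_eq_negSquareEnergy_of_isBipartite <|
      isBipartite_sup_edge hT.isBipartite p (by rw [hp, Nat.odd_iff]; omega)
    constructor <;> linarith
  · have hlt := negSquareEnergy_lt_posSquareEnergy_sup_edge hT hne hadj (m := 2 * (k / 4) + 1)
      (odd_two_mul_add_one _) (by omega)
    constructor <;> linarith
  · have hlt := posSquareEnergy_lt_negSquareEnergy_sup_edge hT hne hadj (m := 2 * (k / 4))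
      (even_two_mul _) (by omega)
    constructor <;> linarith
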